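/- Let $X$ be a real Hilbert space with inner product $\langle\cdot,\cdot\rangle$, and let $X\times X$ carry the product Hilbert space structure. For a function $f\colon X\times X\to[-\infty,+\infty]$ let $\partial f(u)$ be the set of all $v\in X\times X$ with $f(w)\ge f(u)+\langle w-u,v\rangle$ for all $w\in X\times X$ if $f(u)$ is finite, and $\partial f(u)=\varnothing$ otherwise. For a set-valued operator $A\colon X\rightrightarrows X$ with graph $\operatorname{gra}A=\{(x,x^*)\in X\times X : x^*\in Ax\}$, let $$\Phi_A(x,x^*)=\sup_{(a,a^*)\in\operatorname{gra}A}\big(\langle x,a^*\rangle+\langle a,x^*\rangle-\langle a,a^*\rangle\big)$$ be its Fitzpatrick function, let $$\Phi_A^*(y^*,y)=\sup_{(x,x^*)\in X\times X}\big(\langle x,y^*\rangle+\langle y,x^*\rangle-\Phi_A(x,x^*)\big)$$ be the Fenchel conjugate of $\Phi_A$, and let $$\Psi_A(x,x^*)=\inf\Big(\tfrac12\Phi_A(y,y^*)+\tfrac12\Phi_A^*(z^*,z)+\tfrac18\big(\|y-z\|^2+\|y^*-z^*\|^2\big)\Big),$$ where the infimum is over all $(y,y^*),(z,z^*)\in X\times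 X$ with $(x,x^*)=\tfrac12(y+z,y^*+z^*)$ (with the convention $-\infty+\infty=-\infty$, which matters only if $\operatorname{gra}A=\varnothing$). The proximal-average extension $\widetilde A\colon X\rightrightarrows X$ of $A$ is defined by $$\operatorname{gra}\widetilde A=\{(x,x^*)\in X\times X : (x^*,x)\in\partial\Psi_A(x,x^*)\}.$$ **Theorem.** Let $A\colon X\rightrightarrows X$ be monotone, i.e. $\langle x-y,x^*-y^*\rangle\ge 0$ for all $(x,x^*),(y,y^*)\in\operatorname{gra}A$. Define $B\colon X\rightrightarrows X$ by: $x^*\in Bx$ if and only if there are $x_1,x_1^*,x_2,x_2^*\in X$ such that $$(x,x^*)=\tfrac12(x_1+x_2,\,x_1^*+x_2^*),\qquad (x_2^*,x_2)\in\partial\Phi_A(x_1,x_1^*),\qquad x_1-x_2=x_1^*-x_2^*.$$ Then $B=\widetilde A$. -/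

import Mathlib

noncomputable section

namespace ProxExt

open scoped RealInnerProductSpace

variable {X : Type*} [NormedAddCommGroup X] [InnerProductSpace ℝ X]

/-- The graph of a set-valued operator `A : X ⇉ X`. -/
def graph (A : X → Set X) : Set (X × X) := {p | p.2 ∈ A p.1}

/-- Monotonicity of a set-valued operator. -/
def IsMonotone (A : X → Set X) : Prop :=
  ∀ p ∈ graph A, ∀ q ∈ graph A, 0 ≤ ⟪p.1 - q.1, p.2 - q.2⟫

/-- The inner product of the Hilbert product space `X × X`,
`⟨(x, y), (u, v)⟩ = ⟨x, u⟩ + ⟨y, v⟩`. -/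
def pairing (p q : X × X) : ℝ := ⟪p.1, q.1⟫ + ⟪p.2, q.2⟫

/-- The Fitzpatrick function
`Φ_A (x, x*) = sup {⟨x, a*⟩ + ⟨a, x*⟩ - ⟨a, a*⟩ | (a, a*) ∈ gra A}`, with values in `[-∞, ∞]`. -/
def fitzpatrick (A : X → Set X) (p : X × X) : EReal :=
  ⨆ a ∈ graph A, ((⟪p.1, a.2⟫ + ⟪a.1, p.2⟫ - ⟪a.1, a.2⟫ : ℝ) : EReal)

/-- The Fenchel conjugate of an extended-real-valued function on the Hilbert product space
`X × X`. -/
def conjugate (f : X × X → EReal) (q : X × X) : EReal :=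
  ⨆ p : X × X, ((pairing p q : ℝ) : EReal) - f p

/-- The subdifferential of an extended-real-valued function on the Hilbert product space `X × X`;
it is empty at points where the function is not finite. -/
def subdifferential (f : X × X → EReal) (p : X × X) : Set (X × X) :=
  {q | f p ≠ ⊥ ∧ f p ≠ ⊤ ∧ ∀ r : X × X, f p + ((pairing (r - p) q : ℝ) : EReal) ≤ f r}

/-- The proximal average `Ψ_A` between `Φ_A` and the transpose of its conjugate: the infimum
over all decompositions `(x, x*) = ½ (y + z, y* + z*)` of
`½ Φ_A (y, y*) + ½ Φ_A^* (z*, z) + ⅛ (‖y - z‖² + ‖y* - z*‖²)`. -/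
def proximalAverage (A : X → Set X) (p : X × X) : EReal :=
  ⨅ (y : X × X) (z : X × X) (_ : p = (1 / 2 : ℝ) • (y + z)),
    ((1 / 2 : ℝ) : EReal) * fitzpatrick A y
      + ((1 / 2 : ℝ) : EReal) * conjugate (fitzpatrick A) (z.2, z.1)
      + ((1 / 8 * (‖y.1 - z.1‖ ^ 2 + ‖y.2 - z.2‖ ^ 2) : ℝ) : EReal)

/-- The proximal-average extension `Ã`, with
`gra Ã = {(x, x*) | (x*, x) ∈ ∂Ψ_A (x, x*)}`. -/
def extension (A : X → Set X) (x : X) : Set X :=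
  {xs | (xs, x) ∈ subdifferential (proximalAverage A) (x, xs)}

end ProxExt

end

namespace ProxExt

open scoped RealInnerProductSpace
open Filter Topology

/-! ### Coordinate swap and Hilbert pairing on `X × X` -/

section Swap

variable {X : Type*} [NormedAddCommGroup X]

/-! Write Φ for the Fitzpatrick function, G(z) = Φ*(z.swap), u and v for the two points averaged in
the definition of `B`; the condition on differences says that `u - v` is swap-invariant.

From `B` to the extension: equality in Fenchel–Young evaluates G(v), and adding the subgradient
bound for Φ at u, Fenchel–Young for G and the expansion of a square proves the subgradient
inequality for the proximal average.

Conversely, let `p.swap` be a subgradient at p. The infimum is attained at some `p + d`, `p - d` by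
strong convexity and completeness. First-order optimality puts `p.swap - d` in ∂Φ(p + d) and `p.swap
+ d` in ∂G(p - d). Combining these with Fenchel–Young gives ‖d - d.swap‖² ≤ 0, so `d` is
swap-invariant and u = p + d, v = p - d work.

Φ and G are handled only through real upper bounds and affine minorants, which supply convexity and
lower semicontinuity. -/

theorem swap_sub (p q : X × X) : (p - q).swap = p.swap - q.swap := rfl

theorem swap_add (p q : X × X) : (p + q).swap = p.swap + q.swap := rfl

theorem swap_smul [InnerProductSpace ℝ X] (c : ℝ) (p : X × X) : (c • p).swap = c • p.swap := rfl

end Swap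

section Pairing

variable {X : Type*} [NormedAddCommGroup X] [InnerProductSpace ℝ X]

theorem pairing_comm (p q : X × X) : pairing p q = pairing q p := by
  simp only [pairing, real_inner_comm]

theorem pairing_add_left (p q r : X × X) : pairing (p + q) r = pairing p r + pairing q r := by
  simp only [pairing, Prod.fst_add, Prod.snd_add, inner_add_left]; ring

theorem pairing_sub_left (p q r : X × X) : pairing (p - q) r = pairing p r - pairing q r := by
  simp only [pairing, Prod.fst_sub, Prod.snd_sub, inner_sub_left]; ring

theorem pairing_smul_left (c : ℝ) (p r : X × X) : pairing (c • p) r = c * pairing p r := by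
  simp only [pairing, Prod.smul_fst, Prod.smul_snd, real_inner_smul_left]; ring

theorem pairing_add_right (p q r : X × X) : pairing r (p + q) = pairing r p + pairing r q := by
  simp only [pairing_comm r, pairing_add_left]

theorem pairing_sub_right (p q r : X × X) : pairing r (p - q) = pairing r p - pairing r q := by
  simp only [pairing_comm r, pairing_sub_left]

theorem pairing_smul_right (c : ℝ) (p r : X × X) : pairing r (c • p) = c * pairing r p := by
  simp only [pairing_comm r, pairing_smul_left]

theorem pairing_swap_swap (p q : X × X) : pairing p.swap q.swap = pairing p q := by
  simp only [pairing, Prod.fst_swap, Prod.snd_swap]; ring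

theorem pairing_swap_left (p q : X × X) : pairing p.swap q = pairing p q.swap := by
  simp only [pairing, Prod.fst_swap, Prod.snd_swap]; ring

theorem pairing_self (p : X × X) : pairing p p = ‖p.1‖ ^ 2 + ‖p.2‖ ^ 2 := by
  simp only [pairing, real_inner_self_eq_norm_sq]

theorem pairing_self_nonneg (p : X × X) : 0 ≤ pairing p p := by
  rw [pairing_self]; positivity

theorem eq_zero_of_pairing_self_nonpos {p : X × X} (h : pairing p p ≤ 0) : p = 0 := by
  rw [pairing_self] at h
  have h1 : ‖p.1‖ = 0 := by nlinarith [sq_nonneg ‖p.1‖, sq_nonneg ‖p.2‖]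
  have h2 : ‖p.2‖ = 0 := by nlinarith [sq_nonneg ‖p.1‖, sq_nonneg ‖p.2‖]
  exact Prod.ext (norm_eq_zero.1 h1) (norm_eq_zero.1 h2)

/-- `‖p‖` is the sup norm on the product, not the Hilbert norm; this comparison lets Hilbert
estimates yield Cauchy sequences. -/
theorem norm_sq_le_pairing_self (p : X × X) : ‖p‖ ^ 2 ≤ pairing p p := by
  rw [pairing_self, Prod.norm_def]
  rcases max_choice ‖p.1‖ ‖p.2‖ with h | h <;> rw [h] <;>
    nlinarith [sq_nonneg ‖p.1‖, sq_nonneg ‖p.2‖]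

end Pairing

theorem exists_real_of_half_add_half_add_lt {a b : EReal} {q c : ℝ} (ha : a ≠ ⊥) (hb : b ≠ ⊥)
    (h : ((1 / 2 : ℝ) : EReal) * a + ((1 / 2 : ℝ) : EReal) * b + (q : EReal) < (c : EReal)) :
    ∃ s t : ℝ, a ≤ (s : EReal) ∧ b ≤ (t : EReal) ∧ 1 / 2 * s + 1 / 2 * t + q < c := by
  have h2 : (0 : ℝ) < 1 / 2 := by norm_num
  induction a with
  | bot => exact absurd rfl ha
  | top =>
    induction b with
    | bot => exact absurd rfl hb
    | top =>
      rw [EReal.coe_mul_top_of_pos h2, EReal.top_add_top, EReal.top_add_coe] at h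
      exact absurd h not_top_lt
    | coe t =>
      rw [EReal.coe_mul_top_of_pos h2, ← EReal.coe_mul, EReal.top_add_coe,
        EReal.top_add_coe] at h
      exact absurd h not_top_lt
  | coe s =>
    induction b with
    | bot => exact absurd rfl hb
    | top =>
      rw [EReal.coe_mul_top_of_pos h2, ← EReal.coe_mul, EReal.coe_add_top,
        EReal.top_add_coe] at h
      exact absurd h not_top_lt
    | coe t => exact ⟨s, t, le_rfl, le_rfl, by exact_mod_cast h⟩

/-! ### Suprema of affine functions: convexity, optimality, attainment -/

section AffineSup

variable {X : Type*} [NormedAddCommGroup X] [InnerProductSpace ℝ X]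

/-- `f` is the supremum of the affine functions `⟨·, b⟩ - β` with `(b, β) ∈ S`, expressed through
its real sublevel sets. -/
def IsAffineSup (S : Set ((X × X) × ℝ)) (f : X × X → EReal) : Prop :=
  ∀ (u : X × X) (c : ℝ), f u ≤ (c : EReal) ↔ ∀ b ∈ S, pairing u b.1 - b.2 ≤ c

theorem IsAffineSup.convex {S : Set ((X × X) × ℝ)} {f : X × X → EReal} (hf : IsAffineSup S f)
    {u v : X × X} {a b t : ℝ} (hu : f u ≤ (a : EReal)) (hv : f v ≤ (b : EReal))
    (h0 : 0 ≤ t) (h1 : t ≤ 1) :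
    f (u + t • (v - u)) ≤ (((1 - t) * a + t * b : ℝ) : EReal) := by
  rw [hf] at *
  intro c hc
  simp only [pairing_add_left, pairing_smul_left, pairing_sub_left]
  nlinarith [mul_le_mul_of_nonneg_left (hu c hc) (sub_nonneg.2 h1),
    mul_le_mul_of_nonneg_left (hv c hc) h0]

theorem IsAffineSup.ne_bot {S : Set ((X × X) × ℝ)} {f : X × X → EReal} (hf : IsAffineSup S f)
    (hS : S.Nonempty) (u : X × X) : f u ≠ ⊥ := by
  obtain ⟨b, hb⟩ := hS
  intro h
  have := (hf u (pairing u b.1 - b.2 - 1)).1 (h ▸ bot_le) b hb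
  linarith

theorem mem_subdifferential_iff {f : X × X → EReal} {p q : X × X} :
    q ∈ subdifferential f p ↔ ∃ s : ℝ, f p ≤ (s : EReal) ∧
      ∀ (r : X × X) (s' : ℝ), f r ≤ (s' : EReal) → s + pairing (r - p) q ≤ s' := by
  constructor
  · rintro ⟨hb, ht, h⟩
    lift f p to ℝ using ⟨ht, hb⟩ with s
    refine ⟨s, le_rfl, fun r s' hr => ?_⟩
    exact_mod_cast (h r).trans hr
  · rintro ⟨s, hs, h⟩
    have hbot : ∀ r, f r ≠ ⊥ := by
      intro r hr
      have := h r (s + pairing (r - p) q - 1) (hr ▸ bot_le)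
      linarith
    have htop : f p ≠ ⊤ := fun ht => by simp [ht] at hs
    refine ⟨hbot p, htop, fun r => ?_⟩
    by_cases hr : f r = ⊤
    · rw [hr]; exact le_top
    · have hb := hbot r
      have h' := h r
      lift f r to ℝ using ⟨hr, hb⟩ with s'
      have := h' s' le_rfl
      calc f p + ((pairing (r - p) q : ℝ) : EReal) ≤ (s : EReal) + (pairing (r - p) q : ℝ) := by
            gcongr
        _ ≤ s' := by exact_mod_cast this

/-- First-order optimality condition: a minimiser of a convex function plus a quadratic. -/
theorem IsAffineSup.subgradient_of_minimizer {S : Set ((X × X) × ℝ)} {f : X × X → EReal}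
    (hf : IsAffineSup S f) {y z w : X × X} {s : ℝ} (hs : f y ≤ (s : EReal))
    (hmin : ∀ (r : X × X) (s' : ℝ), f r ≤ (s' : EReal) →
      1 / 2 * s + 1 / 8 * pairing (y - z) (y - z) + 1 / 2 * pairing (r - y) w
        ≤ 1 / 2 * s' + 1 / 8 * pairing (r - z) (r - z))
    (r : X × X) (s' : ℝ) (hr : f r ≤ (s' : EReal)) :
    s + pairing (r - y) (w - (1 / 2 : ℝ) • (y - z)) ≤ s' := by
  -- Compare `y` with the segment point `y + t • (r - y)`, divide by `t`, then let `t` tend to 0;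
  -- only the quadratic remainder carries a factor `t`.
  have key : ∀ t : ℝ, 0 < t → t ≤ 1 →
      s + pairing (r - y) (w - (1 / 2 : ℝ) • (y - z))
        ≤ s' + t * (1 / 4 * pairing (r - y) (r - y)) := by
    intro t h0 h1
    have h := hmin _ _ (hf.convex hs hr h0.le h1)
    have e1 : y + t • (r - y) - y = t • (r - y) := by abel
    have e2 : y + t • (r - y) - z = (y - z) + t • (r - y) := by abel
    rw [e1, e2] at h
    generalize r - y = d at *
    generalize y - z = e at *
    simp only [pairing_add_left, pairing_add_right, pairing_smul_left, pairing_smul_right,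
      pairing_sub_right, pairing_comm e d] at h ⊢
    refine le_of_mul_le_mul_left ?_ h0
    nlinarith
  have hlim : Tendsto (fun t : ℝ => s' + t * (1 / 4 * pairing (r - y) (r - y))) (𝓝[>] 0)
      (𝓝 s') := by
    have : Tendsto (fun t : ℝ => s' + t * (1 / 4 * pairing (r - y) (r - y))) (𝓝 0)
        (𝓝 (s' + 0 * (1 / 4 * pairing (r - y) (r - y)))) := by
      apply Continuous.tendsto; fun_prop
    simpa using this.mono_left nhdsWithin_le_nhds
  refine ge_of_tendsto hlim ?_
  filter_upwards [Ioc_mem_nhdsGT (zero_lt_one' ℝ)] with t ht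
  exact key t ht.1 ht.2

/-- The infimum in a proximal average is attained. -/
theorem exists_proximal_minimizer [CompleteSpace X] {S T : Set ((X × X) × ℝ)}
    {f g : X × X → EReal} (hf : IsAffineSup S f) (hg : IsAffineSup T g) (hS : S.Nonempty)
    (hT : T.Nonempty) (p : X × X) (m : ℝ)
    (hlow : ∀ (d : X × X) (s t : ℝ), f (p + d) ≤ (s : EReal) → g (p - d) ≤ (t : EReal) →
      m ≤ 1 / 2 * s + 1 / 2 * t + 1 / 2 * pairing d d)
    (happ : ∀ ε : ℝ, 0 < ε → ∃ (d : X × X) (s t : ℝ), f (p + d) ≤ (s : EReal) ∧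
      g (p - d) ≤ (t : EReal) ∧ 1 / 2 * s + 1 / 2 * t + 1 / 2 * pairing d d < m + ε) :
    ∃ (d : X × X) (s t : ℝ), f (p + d) ≤ (s : EReal) ∧ g (p - d) ≤ (t : EReal) ∧
      1 / 2 * s + 1 / 2 * t + 1 / 2 * pairing d d ≤ m := by
  have hpos : ∀ n : ℕ, (0 : ℝ) < (1 / 2) ^ n := fun n => by positivity
  choose d s t hs ht hst using fun n : ℕ => happ _ (hpos n)
  -- Parallelogram identity: the midpoint of two near-minimisers still has value at least `m`.
  have hclose : ∀ i j : ℕ, pairing (d i - d j) (d i - d j)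
      ≤ 4 * ((1 / 2) ^ i + (1 / 2) ^ j) := by
    intro i j
    have h1 := hf.convex (t := 1 / 2) (hs i) (hs j) (by norm_num) (by norm_num)
    have h2 := hg.convex (t := 1 / 2) (ht i) (ht j) (by norm_num) (by norm_num)
    have e1 : p + d i + (1 / 2 : ℝ) • (p + d j - (p + d i))
        = p + (1 / 2 : ℝ) • (d i + d j) := by module
    have e2 : p - d i + (1 / 2 : ℝ) • (p - d j - (p - d i))
        = p - (1 / 2 : ℝ) • (d i + d j) := by module
    rw [e1] at h1
    rw [e2] at h2
    have h3 := hlow _ _ _ h1 h2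
    have h4 := hst i
    have h5 := hst j
    simp only [pairing_add_left, pairing_add_right, pairing_smul_left, pairing_smul_right,
      pairing_sub_left, pairing_sub_right, pairing_comm (d j) (d i)] at h3 ⊢
    linarith
  have hcauchy : CauchySeq d := by
    rw [Metric.cauchySeq_iff']
    intro ε hε
    obtain ⟨N, hN⟩ := exists_pow_lt_of_lt_one (show 0 < ε ^ 2 / 8 by positivity)
      (show (1 / 2 : ℝ) < 1 by norm_num)
    refine ⟨N, fun n hn => ?_⟩
    have h1 := hclose n N
    have h2 := norm_sq_le_pairing_self (d n - d N)
    have h3 : ((1 : ℝ) / 2) ^ n ≤ (1 / 2) ^ N :=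
      pow_le_pow_of_le_one (by norm_num) (by norm_num) hn
    rw [dist_eq_norm]
    exact lt_of_pow_lt_pow_left₀ 2 hε.le (by linarith)
  obtain ⟨e, he⟩ := cauchySeq_tendsto_of_complete hcauchy
  -- Each pair of minorants is continuous, so its bound passes to the limit.
  have hbound : ∀ b ∈ S, ∀ c ∈ T, (pairing (p + e) b.1 - b.2)
      ≤ 2 * m - pairing e e - (pairing (p - e) c.1 - c.2) := by
    intro b hb c hc
    have hcont : Continuous fun x : X × X => 1 / 2 * (pairing (p + x) b.1 - b.2)
        + 1 / 2 * (pairing (p - x) c.1 - c.2) + 1 / 2 * pairing x x := by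
      unfold pairing; fun_prop
    have hl := (hcont.tendsto e).comp he
    have hr : Tendsto (fun n : ℕ => m + (1 / 2 : ℝ) ^ n) atTop (𝓝 (m + 0)) :=
      (tendsto_pow_atTop_nhds_zero_of_lt_one (by norm_num) (by norm_num)).const_add m
    have := le_of_tendsto_of_tendsto' hl hr (fun n => by
      have h1 := (hf _ _).1 (hs n) b hb
      have h2 := (hg _ _).1 (ht n) c hc
      have h3 := hst n
      simp only [Function.comp]
      linarith)
    linarith
  -- A real separating the two families splits the joint bound into individual bounds for `f` and
  -- `g`.
  obtain ⟨a, ha1, ha2⟩ := exists_between_of_forall_le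
    (hS.image fun b => pairing (p + e) b.1 - b.2)
    (hT.image fun c => 2 * m - pairing e e - (pairing (p - e) c.1 - c.2)) (by
      rintro _ ⟨b, hb, rfl⟩ _ ⟨c, hc, rfl⟩
      exact hbound b hb c hc)
  refine ⟨e, a, 2 * m - pairing e e - a, (hf _ _).2 fun b hb => ha1 ⟨b, hb, rfl⟩,
    (hg _ _).2 fun c hc => ?_, by linarith⟩
  have := ha2 ⟨c, hc, rfl⟩
  simp only at this
  linarith

end AffineSup

/-! ### Fitzpatrick function, transposed conjugate and proximal average -/

section Fitzpatrick

variable {X : Type*} [NormedAddCommGroup X] [InnerProductSpace ℝ X] (A : X → Set X)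

/-- The affine minorants defining the Fitzpatrick function. -/
def fitzpatrickMinorants : Set ((X × X) × ℝ) := (fun a => (a.swap, ⟪a.1, a.2⟫)) '' graph A

/-- The affine minorants defining the transposed conjugate of the Fitzpatrick function. -/
def conjugateMinorants : Set ((X × X) × ℝ) :=
  {b | fitzpatrick A b.1.swap ≤ (b.2 : EReal)}

theorem isAffineSup_fitzpatrick : IsAffineSup (fitzpatrickMinorants A) (fitzpatrick A) := by
  intro u c
  simp only [fitzpatrick, fitzpatrickMinorants, iSup_le_iff, EReal.coe_le_coe_iff,
    Set.forall_mem_image, pairing, Prod.fst_swap, Prod.snd_swap, real_inner_comm u.2]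

theorem fitzpatrickMinorants_nonempty (hne : (graph A).Nonempty) :
    (fitzpatrickMinorants A).Nonempty := hne.image _

theorem isAffineSup_conjugate (hne : (graph A).Nonempty) :
    IsAffineSup (conjugateMinorants A) fun z => conjugate (fitzpatrick A) z.swap := by
  intro u c
  simp only [conjugate, iSup_le_iff, conjugateMinorants, Set.mem_ofPred_eq]
  constructor
  · rintro h ⟨b, β⟩ hb
    have h1 := h b.swap
    rw [pairing_swap_swap, pairing_comm] at h1
    have h2 : ((pairing u b : ℝ) : EReal) - (β : EReal) ≤ c :=
      (EReal.sub_le_sub le_rfl hb).trans h1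
    exact_mod_cast h2
  · intro h r
    by_cases ht : fitzpatrick A r = ⊤
    · simp [ht]
    · have hb := (isAffineSup_fitzpatrick A).ne_bot (fitzpatrickMinorants_nonempty A hne) r
      have hr := h (r.swap, (fitzpatrick A r).toReal)
        (by rw [Prod.swap_swap, EReal.coe_toReal ht hb])
      rw [← EReal.coe_toReal ht hb]
      rw [pairing_comm, pairing_swap_left]
      exact_mod_cast hr

variable {A}

theorem fitzpatrick_le_of_mem_graph (hA : IsMonotone A) {a : X × X} (ha : a ∈ graph A) :
    fitzpatrick A a ≤ ((⟪a.1, a.2⟫ : ℝ) : EReal) := by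
  simp only [fitzpatrick, iSup_le_iff, EReal.coe_le_coe_iff]
  intro b hb
  have := hA a ha b hb
  simp only [inner_sub_left, inner_sub_right] at this
  linarith

/-- Monotonicity enters here: it makes Φ finite on the graph, so G never takes the value -∞. -/
theorem conjugateMinorants_nonempty (hA : IsMonotone A) (hne : (graph A).Nonempty) :
    (conjugateMinorants A).Nonempty := by
  obtain ⟨a, ha⟩ := hne
  exact ⟨(a.swap, ⟪a.1, a.2⟫), by
    simpa [conjugateMinorants] using fitzpatrick_le_of_mem_graph hA ha⟩

theorem pairing_sub_le_of_mem_graph {u a : X × X} (ha : a ∈ graph A) {s : ℝ}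
    (hu : fitzpatrick A u ≤ (s : EReal)) : pairing u a.swap - ⟪a.1, a.2⟫ ≤ s :=
  (isAffineSup_fitzpatrick A u s).1 hu _ ⟨a, ha, rfl⟩

theorem pairing_sub_le_of_conjugate_le (hne : (graph A).Nonempty) {z r : X × X} {s t : ℝ}
    (hz : conjugate (fitzpatrick A) z.swap ≤ (t : EReal))
    (hr : fitzpatrick A r ≤ (s : EReal)) : pairing z r.swap - s ≤ t :=
  (isAffineSup_conjugate A hne z t).1 hz (r.swap, s) hr

theorem conjugate_le_of_mem_graph (hne : (graph A).Nonempty) {a : X × X} (ha : a ∈ graph A) :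
    conjugate (fitzpatrick A) a.swap ≤ ((⟪a.1, a.2⟫ : ℝ) : EReal) := by
  refine (isAffineSup_conjugate A hne a _).2 fun b hb => ?_
  have := pairing_sub_le_of_mem_graph ha hb
  rw [pairing_swap_swap, pairing_comm] at this
  linarith

/-- A subgradient inequality for the transposed conjugate at `z` bounds the Fitzpatrick function
at the subgradient. -/
theorem fitzpatrick_le_of_conjugate_subgradient (hne : (graph A).Nonempty) {z v : X × X} {t : ℝ}
    (h : ∀ (r : X × X) (t' : ℝ), conjugate (fitzpatrick A) r.swap ≤ (t' : EReal) →
      t + pairing (r - z) v.swap ≤ t') :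
    fitzpatrick A v ≤ ((pairing z v.swap - t : ℝ) : EReal) := by
  refine (isAffineSup_fitzpatrick A v _).2 ?_
  rintro _ ⟨a, ha, rfl⟩
  -- Testing only at graph points, where G is at most ⟨a, a*⟩, recovers every minorant of Φ and
  -- avoids biconjugation.
  have := h a _ (conjugate_le_of_mem_graph hne ha)
  rw [pairing_sub_left, ← pairing_swap_left, pairing_comm _ v] at this
  simp only
  linarith

theorem proximalAverage_le {y z : X × X} {s t : ℝ} (hy : fitzpatrick A y ≤ (s : EReal))
    (hz : conjugate (fitzpatrick A) z.swap ≤ (t : EReal)) :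
    proximalAverage A ((1 / 2 : ℝ) • (y + z))
      ≤ ((1 / 2 * s + 1 / 2 * t + 1 / 8 * pairing (y - z) (y - z) : ℝ) : EReal) := by
  refine (iInf_le_of_le y <| iInf_le_of_le z <| iInf_le _ rfl).trans ?_
  rw [pairing_self, EReal.coe_add, EReal.coe_add, EReal.coe_mul, EReal.coe_mul]
  have h2 : (0 : EReal) ≤ ((1 / 2 : ℝ) : EReal) := by
    exact_mod_cast (by norm_num : (0 : ℝ) ≤ 1 / 2)
  exact add_le_add (add_le_add (mul_le_mul_of_nonneg_left hy h2)
    (mul_le_mul_of_nonneg_left hz h2)) le_rfl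

theorem exists_of_proximalAverage_lt (hA : IsMonotone A) (hne : (graph A).Nonempty) {p : X × X}
    {c : ℝ} (h : proximalAverage A p < (c : EReal)) :
    ∃ (y z : X × X) (s t : ℝ), p = (1 / 2 : ℝ) • (y + z) ∧ fitzpatrick A y ≤ (s : EReal) ∧
      conjugate (fitzpatrick A) z.swap ≤ (t : EReal) ∧
      1 / 2 * s + 1 / 2 * t + 1 / 8 * pairing (y - z) (y - z) < c := by
  simp only [proximalAverage, iInf_lt_iff] at h
  obtain ⟨y, z, hp, h⟩ := h
  change _ + _ * conjugate (fitzpatrick A) z.swap + _ < _ at h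
  have hyb := (isAffineSup_fitzpatrick A).ne_bot (fitzpatrickMinorants_nonempty A hne) y
  have hzb := (isAffineSup_conjugate A hne).ne_bot (conjugateMinorants_nonempty hA hne) z
  rw [← Prod.fst_sub, ← Prod.snd_sub, ← pairing_self] at h
  obtain ⟨s, t, hs, ht, hst⟩ := exists_real_of_half_add_half_add_lt hyb hzb h
  exact ⟨y, z, s, t, hp, hs, ht, hst⟩

theorem le_proximalAverage (hA : IsMonotone A) (hne : (graph A).Nonempty) {p : X × X} {c : ℝ}
    (h : ∀ (y z : X × X) (s t : ℝ), p = (1 / 2 : ℝ) • (y + z) → fitzpatrick A y ≤ (s : EReal) →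
      conjugate (fitzpatrick A) z.swap ≤ (t : EReal) →
      c ≤ 1 / 2 * s + 1 / 2 * t + 1 / 8 * pairing (y - z) (y - z)) :
    (c : EReal) ≤ proximalAverage A p := by
  by_contra! hlt
  obtain ⟨y, z, s, t, hp, hy, hz, hlt⟩ := exists_of_proximalAverage_lt hA hne hlt
  exact absurd (h y z s t hp hy hz) (not_le.2 hlt)

/-! ### The two inclusions -/

theorem swap_mem_subdifferential_proximalAverage (hA : IsMonotone A) (hne : (graph A).Nonempty)
    {u v : X × X} (h : v.swap ∈ subdifferential (fitzpatrick A) u)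
    (huv : (u - v).swap = u - v) :
    ((1 / 2 : ℝ) • (u + v)).swap
      ∈ subdifferential (proximalAverage A) ((1 / 2 : ℝ) • (u + v)) := by
  rw [mem_subdifferential_iff] at h ⊢
  obtain ⟨s, hs, h⟩ := h
  have hv : conjugate (fitzpatrick A) v.swap ≤ ((pairing u v.swap - s : ℝ) : EReal) := by
    refine (isAffineSup_conjugate A hne v _).2 fun b hb => ?_
    have := h _ _ hb
    rw [pairing_sub_left, pairing_swap_swap, pairing_comm b.1] at this
    linarith
  refine ⟨_, proximalAverage_le hs hv, fun r s' hr => ?_⟩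
  refine EReal.coe_le_coe_iff.1 (le_trans ?_ hr)
  refine le_proximalAverage hA hne fun y z a b hyz hy hz => ?_
  subst hyz
  have h1 := h y a hy
  have h2 := pairing_sub_le_of_conjugate_le hne hz hs
  -- Bounds ‖y - z‖² below by its tangent at `u - v`; swap-invariance turns the linear term into one
  -- that combines with `h1` and `h2`.
  have h3 := pairing_self_nonneg ((y - z) - (u - v))
  have e1 : pairing (y - z) (u - v) = pairing (y - z) (u - v).swap := by rw [huv]
  have e2 : pairing (u - v) (u - v) = pairing (u - v) (u - v).swap := by rw [huv]
  rw [pairing_sub_left, pairing_sub_right (y - z), pairing_sub_right (y - z),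
    pairing_comm (u - v) (y - z), e1, e2] at h3
  rw [e2]
  have e3 : pairing v u.swap = pairing u v.swap := by rw [pairing_comm, pairing_swap_left]
  simp only [pairing_add_left, pairing_smul_left, pairing_sub_left, pairing_add_right,
    pairing_smul_right, pairing_sub_right, swap_add, swap_sub, swap_smul, e3] at *
  linarith

theorem exists_of_swap_mem_subdifferential_proximalAverage [CompleteSpace X] (hA : IsMonotone A)
    (hne : (graph A).Nonempty) {p : X × X}
    (h : p.swap ∈ subdifferential (proximalAverage A) p) :
    ∃ u v : X × X, p = (1 / 2 : ℝ) • (u + v) ∧ v.swap ∈ subdifferential (fitzpatrick A) u ∧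
      (u - v).swap = u - v := by
  rw [mem_subdifferential_iff] at h
  obtain ⟨m, hm, h⟩ := h
  have hF := isAffineSup_fitzpatrick A
  have hG := isAffineSup_conjugate A hne
  obtain ⟨d, s, t, hs, ht, hst⟩ := exists_proximal_minimizer hF hG
    (fitzpatrickMinorants_nonempty A hne) (conjugateMinorants_nonempty hA hne) p m (by
      intro d s t hs ht
      have h1 := proximalAverage_le hs ht
      have e1 : (1 / 2 : ℝ) • (p + d + (p - d)) = p := by module
      have e2 : p + d - (p - d) = (2 : ℝ) • d := by module
      rw [e1, e2] at h1
      have h2 := h p _ h1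
      rw [pairing_sub_left, sub_self, pairing_smul_left, pairing_smul_right] at h2
      linarith) (by
      intro ε hε
      obtain ⟨y, z, s, t, rfl, hy, hz, hlt⟩ := exists_of_proximalAverage_lt hA hne
        (hm.trans_lt (EReal.coe_lt_coe_iff.2 (lt_add_of_pos_right m hε)))
      refine ⟨(1 / 2 : ℝ) • (y - z), s, t, ?_, ?_, ?_⟩
      · convert hy using 2; module
      · convert hz using 3; module
      · simp only [pairing_smul_left, pairing_smul_right]; linarith)
  have hopt : ∀ (y z : X × X) (s' t' : ℝ), fitzpatrick A y ≤ (s' : EReal) →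
      conjugate (fitzpatrick A) z.swap ≤ (t' : EReal) →
      1 / 2 * s + 1 / 2 * t + 1 / 2 * pairing d d
        + pairing ((1 / 2 : ℝ) • (y + z) - p) p.swap
        ≤ 1 / 2 * s' + 1 / 2 * t' + 1 / 8 * pairing (y - z) (y - z) := by
    intro y z s' t' hy hz
    have := h _ _ (proximalAverage_le hy hz)
    linarith
  have hu := hF.subgradient_of_minimizer (z := p - d) (w := p.swap) hs (by
    intro r s' hr
    have h1 := hopt r (p - d) s' t hr ht
    have e1 : (1 / 2 : ℝ) • (r + (p - d)) - p = (1 / 2 : ℝ) • (r - (p + d)) := by module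
    have e2 : p + d - (p - d) = (2 : ℝ) • d := by module
    rw [e1, pairing_smul_left] at h1
    rw [e2, pairing_smul_left, pairing_smul_right]
    linarith)
  have hv := hG.subgradient_of_minimizer (z := p + d) (w := p.swap) ht (by
    intro r t' hr
    have h1 := hopt (p + d) r s t' hs hr
    have e1 : (1 / 2 : ℝ) • (p + d + r) - p = (1 / 2 : ℝ) • (r - (p - d)) := by module
    have e2 : p - d - (p + d) = (-2 : ℝ) • d := by module
    have e3 : pairing (p + d - r) (p + d - r) = pairing (r - (p + d)) (r - (p + d)) := by
      rw [← neg_sub r (p + d), ← neg_one_smul ℝ (r - (p + d)), pairing_smul_left,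
        pairing_smul_right]
      ring
    rw [e1, pairing_smul_left, e3] at h1
    rw [e2, pairing_smul_left, pairing_smul_right]
    linarith)
  have e1 : p.swap - (1 / 2 : ℝ) • (p + d - (p - d)) = p.swap - d := by module
  have e2 : p.swap - (1 / 2 : ℝ) • (p - d - (p + d)) = (p + d.swap).swap := by
    rw [swap_add, Prod.swap_swap]; module
  rw [e1] at hu
  rw [e2] at hv
  have hFv := fitzpatrick_le_of_conjugate_subgradient hne hv
  -- Tests the subgradient of Φ at `p + d.swap`, where the optimality of G has just bounded Φ.
  have h1 := hu _ _ hFv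
  have h2 := pairing_sub_le_of_conjugate_le hne ht hs
  have hd : d - d.swap = 0 := by
    apply eq_zero_of_pairing_self_nonpos
    have e3 : pairing d p.swap = pairing p d.swap := by rw [pairing_comm, pairing_swap_left]
    simp only [pairing_add_left, pairing_smul_left, pairing_sub_left, pairing_add_right,
      pairing_sub_right, swap_add, swap_sub, Prod.swap_swap, pairing_swap_left,
      pairing_comm d p, e3] at *
    linarith
  have hd' : d.swap = d := (sub_eq_zero.1 hd).symm
  refine ⟨p + d, p - d, by module, ?_, ?_⟩
  · rw [mem_subdifferential_iff]
    refine ⟨s, hs, fun r s' hr => ?_⟩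
    rw [swap_sub, hd']
    exact hu r s' hr
  · simp only [swap_add, swap_sub, hd']
    abel

/-! ### Empty graph: both functions are -∞, so both operators are empty -/

theorem fitzpatrick_eq_bot (hne : ¬ (graph A).Nonempty) (p : X × X) : fitzpatrick A p = ⊥ := by
  simp [fitzpatrick, Set.not_nonempty_iff_eq_empty.1 hne]

theorem proximalAverage_eq_bot (hne : ¬ (graph A).Nonempty) (p : X × X) :
    proximalAverage A p = ⊥ := by
  refine le_bot_iff.1 (iInf_le_of_le p <| iInf_le_of_le p <| iInf_le_of_le (by module) ?_)
  rw [fitzpatrick_eq_bot hne, EReal.coe_mul_bot_of_pos (by norm_num), EReal.bot_add,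
    EReal.bot_add]

end Fitzpatrick

end ProxExt

theorem theorem2p10 {X : Type*} [NormedAddCommGroup X] [InnerProductSpace ℝ X] [CompleteSpace X]
    (A : X → Set X) (hA : ProxExt.IsMonotone A) (B : X → Set X)
    (hB : ∀ x xs : X, xs ∈ B x ↔ ∃ x₁ x₁s x₂ x₂s : X,
      (x, xs) = (1 / 2 : ℝ) • (x₁ + x₂, x₁s + x₂s) ∧
      (x₂s, x₂) ∈ ProxExt.subdifferential (ProxExt.fitzpatrick A) (x₁, x₁s) ∧
      x₁ - x₂ = x₁s - x₂s) :
    B = ProxExt.extension A := by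
  ext x xs
  rw [hB]
  change _ ↔ (x, xs).swap ∈ ProxExt.subdifferential (ProxExt.proximalAverage A) (x, xs)
  by_cases hne : (ProxExt.graph A).Nonempty
  · constructor
    · rintro ⟨x₁, x₁s, x₂, x₂s, hx, hsub, hd⟩
      rw [hx]
      exact ProxExt.swap_mem_subdifferential_proximalAverage hA hne (u := (x₁, x₁s))
        (v := (x₂, x₂s)) hsub (Prod.ext hd.symm hd)
    · intro h
      obtain ⟨u, v, hp, hsub, hd⟩ :=
        ProxExt.exists_of_swap_mem_subdifferential_proximalAverage hA hne h
      exact ⟨u.1, u.2, v.1, v.2, hp, hsub, (congrArg Prod.snd hd)⟩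
  · constructor
    · rintro ⟨x₁, x₁s, x₂, x₂s, -, hsub, -⟩
      exact absurd (ProxExt.fitzpatrick_eq_bot hne _) hsub.1
    · intro h
      exact absurd (ProxExt.proximalAverage_eq_bot hne _) h.1
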